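/- For a prime $p$ and an integer $x$, let $\nu_p(x)=\max\{e\in\mathbb{N} : p^e\mid x\}$, with $\nu_p(0)=+\infty$; for an integer matrix $M$, let $\nu_p(M)=\min_{i,j}\nu_p(M_{ij})$. A sequence $f:\mathbb{N}\to\mathbb{Q}$ (with $0\in\mathbb{N}$) is called eventually periodic if there exist $n_0\in\mathbb{N}$ and an integer $T>0$ such that $f(n+T)=f(n)$ for all $n\ge n_0$. Let $A\in\mathbb{Z}^{m\times m}$ be not nilpotent. Then, for every prime $p$, the valuation $\nu_p(A^n)$ is finite for all $n\in\mathbb{N}$, and there exist a constant $a\in\mathbb{Q}$ with $a\ge 0$ and an eventually periodic sequence $h:\mathbb{N}\to\mathbb{Q}$ such that \[ \nu_p(A^n)=a\,n+h(n)\qquad\text{for all } n\in\mathbb{N}. \] In particular, the sequence $n\mapsto \nu_p(A^{n+1})-\nu_p(A^n)=a+h(n+1)-h(n)$ is eventually periodic. -/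

import Mathlib

/-- A sequence `f : ℕ → ℚ` is eventually periodic if there are a threshold `n₀` and a period
`T > 0` such that `f (n + T) = f n` for all `n ≥ n₀`. -/
def EventuallyPeriodic (f : ℕ → ℚ) : Prop :=
  ∃ n₀ T : ℕ, 0 < T ∧ ∀ n : ℕ, n₀ ≤ n → f (n + T) = f n

/-- The `p`-adic valuation of an integer matrix: the minimum over all entries of the `p`-adic
valuation `max {e : p ^ e ∣ x}` of the entry `x`, with the value `⊤` at the entry `0`. -/
noncomputable def matrixVal (p : ℕ) {m n : ℕ} (M : Matrix (Fin m) (Fin n) ℤ) : ℕ∞ :=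
  ⨅ (i : Fin m) (j : Fin n), emultiplicity (p : ℤ) (M i j)

/-! Let `c k` be the coefficients of the characteristic polynomial and `r / s` the minimum of `ν_p
(c k) / (m - k)` over `k < m` with `c k ≠ 0`; some such `k` exists because `A` is not nilpotent.
Then `ν_p (A ^ n)` stays within a bounded distance of `r * n / s`: p-adic eigenvalues give the upper
bound (`Matrix.exists_slope`), the Cayley–Hamilton recurrence the lower one
(`Matrix.exists_pow_dvd_pow_of_slope`).

Hence, for a fixed `K`, the rescaled powers `C q = p ^ (K - r * q) • A ^ (s * q)` are integral. By
pigeonhole two of them, `C a` and `C b`, are so close p-adically that `A ^ l * C a` and `A ^ l * C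
b` have the same valuation for every `l` (`Matrix.exists_val_pow_add_eq`). This gives `v (n + T) = v
n + c` for large `n`, so the slope is `c / T`. -/

/-! ### Upper bound from p-adic eigenvalues -/

open Polynomial in
theorem Matrix.exists_mulVec_eq_smul_of_isRoot_charpoly {K ι : Type*} [Field K] [Fintype ι]
    [DecidableEq ι] (B : Matrix ι ι K) {μ : K} (h : B.charpoly.IsRoot μ) :
    ∃ x : ι → K, x ≠ 0 ∧ B.mulVec x = μ • x := by
  rw [IsRoot, Matrix.eval_charpoly] at h
  obtain ⟨x, hx, hx0⟩ := Matrix.exists_mulVec_eq_zero_iff.mpr h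
  refine ⟨x, hx, ?_⟩
  rw [Matrix.sub_mulVec, sub_eq_zero] at hx0
  rw [← hx0]
  ext i
  simp [Matrix.scalar_apply, Matrix.mulVec_diagonal]

theorem Matrix.pow_mulVec_eq_smul {K ι : Type*} [CommRing K] [Fintype ι] [DecidableEq ι]
    {B : Matrix ι ι K} {μ : K} {x : ι → K} (h : B.mulVec x = μ • x) (n : ℕ) :
    (B ^ n).mulVec x = μ ^ n • x := by
  induction n with
  | zero => simp
  | succ n ih => rw [pow_succ, ← Matrix.mulVec_mulVec, h, Matrix.mulVec_smul, ih, smul_smul,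
      pow_succ, mul_comm]

/-- Compare both sides of the eigenvector equation at a coordinate where `x` has maximal norm. -/
theorem Matrix.norm_le_of_mulVec_eq_smul {K ι : Type*} [NormedField K] [IsUltrametricDist K]
    [Fintype ι] {B : Matrix ι ι K} {μ : K} {x : ι → K} (hx : x ≠ 0)
    (h : B.mulVec x = μ • x) {C : ℝ} (hC : 0 ≤ C) (hB : ∀ i j, ‖B i j‖ ≤ C) : ‖μ‖ ≤ C := by
  obtain ⟨i₀, hi₀⟩ := Function.ne_iff.mp hx
  obtain ⟨i, -, hi⟩ := Finset.exists_max_image Finset.univ (fun i => ‖x i‖) ⟨i₀, Finset.mem_univ _⟩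
  have hpos : 0 < ‖x i‖ := (norm_pos_iff.mpr hi₀).trans_le (hi i₀ (Finset.mem_univ _))
  refine le_of_mul_le_mul_right ?_ hpos
  have h1 := congrFun h i
  rw [Pi.smul_apply, smul_eq_mul] at h1
  rw [← norm_mul, ← h1, Matrix.mulVec, dotProduct]
  refine IsUltrametricDist.norm_sum_le_of_forall_le_of_nonneg (by positivity) fun j hj => ?_
  rw [norm_mul]
  exact mul_le_mul (hB i j) (hi j hj) (norm_nonneg _) hC

theorem Multiset.norm_prod_pow_le {K : Type*} [NormedField K] (s : Multiset K) (n : ℕ) {C : ℝ}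
    (h : ∀ x ∈ s, ‖x‖ ^ n ≤ C) : ‖s.prod‖ ^ n ≤ C ^ s.card := by
  induction s using Multiset.induction_on with
  | empty => simp
  | cons a s ih =>
    have ha := h a (by simp)
    rw [Multiset.prod_cons, norm_mul, mul_pow, Multiset.card_cons, pow_succ, mul_comm]
    exact mul_le_mul (ih fun x hx => h x (by simp [hx])) ha (by positivity)
      (pow_nonneg ((by positivity : (0 : ℝ) ≤ ‖a‖ ^ n).trans ha) _)

/-- By the ultrametric inequality some single product of `k` elements dominates the sum. Working
with `n`-th powers avoids real roots of `p ^ (-e)`. -/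
theorem Multiset.norm_esymm_pow_le {K : Type*} [NormedField K] [IsUltrametricDist K]
    (s : Multiset K) (n k : ℕ) (hk : k ≤ s.card) {C : ℝ} (h : ∀ x ∈ s, ‖x‖ ^ n ≤ C) :
    ‖s.esymm k‖ ^ n ≤ C ^ k := by
  obtain ⟨t, ht, hle⟩ := IsUltrametricDist.exists_norm_multiset_sum_le
    (s.powersetCard k) (f := Multiset.prod)
  have hne : s.powersetCard k ≠ 0 := by
    rw [← Multiset.card_pos, Multiset.card_powersetCard]
    exact Nat.choose_pos hk
  obtain ⟨hts, htk⟩ := Multiset.mem_powersetCard.mp (ht hne)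
  calc ‖s.esymm k‖ ^ n ≤ ‖t.prod‖ ^ n := pow_le_pow_left₀ (norm_nonneg _) hle n
    _ ≤ C ^ t.card := t.norm_prod_pow_le n fun x hx => h x (Multiset.mem_of_le hts hx)
    _ = C ^ k := by rw [htk]

theorem PadicAlgCl.norm_intCast_le_pow_iff_dvd (p : ℕ) [Fact p.Prime] (z : ℤ) (e : ℕ) :
    ‖(z : PadicAlgCl p)‖ ≤ ((p : ℝ)⁻¹) ^ e ↔ (p : ℤ) ^ e ∣ z := by
  have h : ‖(z : PadicAlgCl p)‖ = ‖(z : ℚ_[p])‖ := by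
    rw [← PadicAlgCl.norm_extends]; simp
  have h2 := Padic.norm_int_le_pow_iff_dvd (p := p) z e
  rw [h]
  rw [zpow_neg, zpow_natCast, ← inv_pow] at h2
  exact_mod_cast h2

/-- If `p ^ e` divides `A ^ n`, every eigenvalue `μ` of `A` satisfies `|μ| ^ n ≤ p ^ (-e)`, which
bounds the coefficients of the characteristic polynomial. -/
theorem Matrix.pow_dvd_charpoly_coeff_pow {m : ℕ} (A : Matrix (Fin m) (Fin m) ℤ) {p : ℕ}
    (hp : p.Prime) {e n : ℕ} (h : ∀ i j, (p : ℤ) ^ e ∣ (A ^ n) i j) {k : ℕ} (hk : k ≤ m) :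
    (p : ℤ) ^ (e * (m - k)) ∣ A.charpoly.coeff k ^ n := by
  have : Fact p.Prime := ⟨hp⟩
  let φ : ℤ →+* PadicAlgCl p := Int.castRingHom _
  let B := A.map φ
  have hB : B.charpoly = A.charpoly.map φ := Matrix.charpoly_map A φ
  have hdeg : B.charpoly.natDegree = m := by simp [Matrix.charpoly_natDegree_eq_dim]
  have hsplit := IsAlgClosed.splits B.charpoly
  have hcard : B.charpoly.roots.card = m := by
    rw [Polynomial.splits_iff_card_roots.mp hsplit, hdeg]
  have hroot : ∀ μ ∈ B.charpoly.roots, ‖μ‖ ^ n ≤ ((p : ℝ)⁻¹) ^ e := by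
    intro μ hμ
    obtain ⟨x, hx, hxμ⟩ := B.exists_mulVec_eq_smul_of_isRoot_charpoly
      (Polynomial.isRoot_of_mem_roots hμ)
    rw [← norm_pow]
    refine Matrix.norm_le_of_mulVec_eq_smul hx (Matrix.pow_mulVec_eq_smul hxμ n)
      (by positivity) fun i j => ?_
    have : B ^ n = (A ^ n).map φ := (Matrix.map_pow A φ n).symm
    rw [this]
    exact (PadicAlgCl.norm_intCast_le_pow_iff_dvd p _ e).mpr (h i j)
  have hco := Polynomial.coeff_eq_esymm_roots_of_splits hsplit (hk.trans hdeg.ge)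
  have hes := B.charpoly.roots.norm_esymm_pow_le n (m - k) (by omega) hroot
  rw [← PadicAlgCl.norm_intCast_le_pow_iff_dvd, Int.cast_pow, norm_pow, pow_mul]
  refine le_trans (le_of_eq ?_) hes
  have : ((A.charpoly.coeff k : ℤ) : PadicAlgCl p) = B.charpoly.coeff k := by
    rw [hB, Polynomial.coeff_map]; rfl
  rw [this, hco, hdeg, (Matrix.charpoly_monic B).leadingCoeff]
  simp

theorem exists_matrixVal_eq {p : ℕ} (hp : p.Prime) {m n : ℕ} {M : Matrix (Fin m) (Fin n) ℤ}
    (hM : M ≠ 0) :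
    ∃ v : ℕ, matrixVal p M = v ∧ ∀ e, e ≤ v ↔ ∀ i j, (p : ℤ) ^ e ∣ M i j := by
  have hle : ∀ e : ℕ, (e : ℕ∞) ≤ matrixVal p M ↔ ∀ i j, (p : ℤ) ^ e ∣ M i j := fun e => by
    simp only [matrixVal, le_iInf_iff, pow_dvd_iff_le_emultiplicity]
  have htop : matrixVal p M ≠ ⊤ := by
    intro h
    apply hM
    ext i j
    by_contra h0
    have hfin : FiniteMultiplicity (p : ℤ) (M i j) :=
      Int.finiteMultiplicity_iff.mpr ⟨by simpa using hp.ne_one, h0⟩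
    refine finiteMultiplicity_iff_emultiplicity_ne_top.mp hfin (top_le_iff.mp ?_)
    rw [← h]
    exact (iInf_le _ i).trans (iInf_le _ j)
  obtain ⟨v, hv⟩ := ENat.ne_top_iff_exists.mp htop
  refine ⟨v, hv.symm, fun e => ?_⟩
  rw [← hle, ← hv, Nat.cast_le]

theorem Matrix.isNilpotent_of_charpoly_coeff_eq_zero {m : ℕ} (A : Matrix (Fin m) (Fin m) ℤ)
    (h : ∀ k < m, A.charpoly.coeff k = 0) : IsNilpotent A := by
  refine ⟨m, ?_⟩
  have h1 := A.aeval_self_charpoly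
  rw [Polynomial.aeval_eq_sum_range, Matrix.charpoly_natDegree_eq_dim, Fintype.card_fin,
    Finset.sum_range_succ, Finset.sum_eq_zero, zero_add] at h1
  · have h2 := A.charpoly_monic.coeff_natDegree
    rw [Matrix.charpoly_natDegree_eq_dim, Fintype.card_fin] at h2
    rwa [h2, one_smul] at h1
  · intro k hk
    rw [h k (Finset.mem_range.mp hk), zero_smul]

/-- The minimal slope `r / s` of the Newton polygon of the characteristic polynomial bounds the
growth of the valuation of `A ^ n` from above. -/
theorem Matrix.exists_slope {m : ℕ} (A : Matrix (Fin m) (Fin m) ℤ) (hA : ¬ IsNilpotent A) {p : ℕ}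
    (hp : p.Prime) :
    ∃ r s : ℕ, 0 < s ∧
      (∀ k < m, ∃ w, (p : ℤ) ^ w ∣ A.charpoly.coeff k ∧ r * (m - k) ≤ s * w) ∧
      ∀ n e : ℕ, (∀ i j, (p : ℤ) ^ e ∣ (A ^ n) i j) → s * e ≤ r * n := by
  classical
  let c := A.charpoly.coeff
  have hex : ∃ k < m, c k ≠ 0 := by
    by_contra! h
    exact hA (A.isNilpotent_of_charpoly_coeff_eq_zero h)
  have hfin : ∀ k, c k ≠ 0 → FiniteMultiplicity (p : ℤ) (c k) := fun k hk =>
    Int.finiteMultiplicity_iff.mpr ⟨by simpa using hp.ne_one, hk⟩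
  -- The minimizing index `i` supplies the slope, unreduced: `r = ν_p (c i)`, `s = m - i`.
  obtain ⟨i, hi, hmin⟩ := Finset.exists_min_image
    ((Finset.range m).filter fun k => c k ≠ 0)
    (fun k => (multiplicity (p : ℤ) (c k) : ℚ) / ((m - k : ℕ) : ℚ))
    (by obtain ⟨k, hk, h⟩ := hex; exact ⟨k, by simp [hk, h]⟩)
  simp only [Finset.mem_filter, Finset.mem_range] at hi hmin
  refine ⟨multiplicity (p : ℤ) (c i), m - i, by omega, fun k hk => ?_, fun n e h => ?_⟩
  · by_cases hck : c k = 0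
    · refine ⟨multiplicity (p : ℤ) (c i) * (m - k), by simp [c] at hck; simp [hck], ?_⟩
      exact Nat.le_mul_of_pos_left _ (by omega)
    · refine ⟨multiplicity (p : ℤ) (c k), pow_multiplicity_dvd _ _, ?_⟩
      have h1 := hmin k ⟨hk, hck⟩
      rw [div_le_div_iff₀ (by exact_mod_cast Nat.sub_pos_of_lt hi.1)
        (by exact_mod_cast Nat.sub_pos_of_lt hk)] at h1
      rw [mul_comm (m - i)]
      exact_mod_cast h1
  · have h1 := A.pow_dvd_charpoly_coeff_pow hp h hi.1.le
    have hpZ : Prime (p : ℤ) := Nat.prime_iff_prime_int.mp hp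
    rw [((hfin i hi.2).pow hpZ).pow_dvd_iff_le_multiplicity,
      (hfin i hi.2).multiplicity_pow hpZ] at h1
    change e * (m - i) ≤ n * multiplicity (p : ℤ) (c i) at h1
    linarith [mul_comm e (m - i), mul_comm n (multiplicity (p : ℤ) (c i))]

/-! ### Lower bound from Cayley–Hamilton -/

theorem Matrix.pow_add_eq_neg_sum {m : ℕ} (A : Matrix (Fin m) (Fin m) ℤ) (d : ℕ) :
    A ^ (d + m) = -∑ k ∈ Finset.range m, A.charpoly.coeff k • A ^ (d + k) := by
  have h1 := A.aeval_self_charpoly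
  have h2 := A.charpoly_monic.coeff_natDegree
  rw [Matrix.charpoly_natDegree_eq_dim, Fintype.card_fin] at h2
  rw [Polynomial.aeval_eq_sum_range, Matrix.charpoly_natDegree_eq_dim, Fintype.card_fin,
    Finset.sum_range_succ, h2, one_smul] at h1
  rw [pow_add, eq_neg_of_add_eq_zero_right h1, mul_neg, Finset.mul_sum]
  simp only [Matrix.mul_smul, pow_add]

/-- If the coefficients of the characteristic polynomial lie above the line of slope `r / s`, the
valuation of `A ^ n` is at least `(n - m) * r / s`. -/
theorem Matrix.exists_pow_dvd_pow_of_slope {m : ℕ} (A : Matrix (Fin m) (Fin m) ℤ) {p r s : ℕ}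
    (hs : 0 < s)
    (hc : ∀ k < m, ∃ w, (p : ℤ) ^ w ∣ A.charpoly.coeff k ∧ r * (m - k) ≤ s * w) (n : ℕ) :
    ∃ w, (∀ i j, (p : ℤ) ^ w ∣ (A ^ n) i j) ∧ r * n ≤ s * w + r * m := by
  induction n using Nat.strong_induction_on with
  | _ n ih =>
    rcases lt_or_ge n m with hn | hn
    · exact ⟨0, by simp, by nlinarith⟩
    · obtain ⟨d, rfl⟩ := Nat.exists_eq_add_of_le' hn
      -- The `k`-th term of the recurrence has valuation at least `r * (m - k) / s + r * (d + k - m)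
      -- / s = r * d / s`, whatever `k` is.
      refine ⟨(r * d) ⌈/⌉ s, fun i j => ?_, ?_⟩
      · rw [A.pow_add_eq_neg_sum, Matrix.neg_apply, dvd_neg, Matrix.sum_apply]
        refine Finset.dvd_sum fun k hk => ?_
        have hk := Finset.mem_range.mp hk
        obtain ⟨w, hw, hrw⟩ := hc k hk
        obtain ⟨w', hw', hrw'⟩ := ih (d + k) (by omega)
        have hle : (r * d) ⌈/⌉ s ≤ w + w' := by
          rw [ceilDiv_le_iff_le_mul hs]
          obtain ⟨a, rfl⟩ := Nat.exists_eq_add_of_lt hk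
          rw [show k + a + 1 - k = a + 1 by omega] at hrw
          nlinarith
        rw [Matrix.smul_apply, smul_eq_mul]
        exact (pow_dvd_pow _ hle).trans (pow_add (p : ℤ) w w' ▸ mul_dvd_mul hw (hw' i j))
      · have := le_smul_ceilDiv (b := r * d) hs
        rw [smul_eq_mul] at this
        nlinarith

/-! ### Periodicity by pigeonhole -/

/-- The quotient by `N • M` is finitely generated and torsion, hence finite, so two terms of the
sequence share a class. -/
theorem Module.exists_lt_sub_eq_smul {M : Type*} [AddCommGroup M] [Module.Finite ℤ M] {N : ℤ}
    (hN : N ≠ 0) (x : ℕ → M) : ∃ a b, a < b ∧ ∃ y, x b - x a = N • y := by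
  let P : Submodule ℤ M := LinearMap.range (LinearMap.lsmul ℤ M N)
  have htor : Module.IsTorsion ℤ (M ⧸ P) := by
    intro z
    obtain ⟨z, rfl⟩ := P.mkQ_surjective z
    refine ⟨⟨N, mem_nonZeroDivisors_of_ne_zero hN⟩, ?_⟩
    change N • P.mkQ z = 0
    rw [← map_smul, Submodule.mkQ_apply, Submodule.Quotient.mk_eq_zero]
    exact ⟨z, rfl⟩
  have : Finite (M ⧸ P) := Module.finite_of_fg_torsion _ htor
  have key : ∀ a b, P.mkQ (x a) = P.mkQ (x b) → ∃ y, x b - x a = N • y := fun a b h => by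
    obtain ⟨y, hy⟩ := (Submodule.Quotient.eq P).mp h.symm
    exact ⟨y, hy.symm⟩
  obtain ⟨a, b, hab, h⟩ := Finite.exists_ne_map_eq_of_infinite fun q => P.mkQ (x q)
  rcases hab.lt_or_gt with hlt | hlt
  · exact ⟨a, b, hlt, key a b h⟩
  · exact ⟨b, a, hlt, key b a h.symm⟩

/-- If the valuation `v n` of `A ^ n` differs from `n * r / s` by a bounded amount, it is eventually
periodic up to a linear term. -/
theorem Matrix.exists_val_pow_add_eq {m : ℕ} (A : Matrix (Fin m) (Fin m) ℤ) {p : ℕ}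
    (hp : p.Prime) {v : ℕ → ℕ} (hv : ∀ n e, e ≤ v n ↔ ∀ i j, (p : ℤ) ^ e ∣ (A ^ n) i j)
    {r s K : ℕ} (hs : 0 < s) (hlow : ∀ n, r * n ≤ s * v n + K) (hup : ∀ n, s * v n ≤ r * n) :
    ∃ n₀ T c, 0 < T ∧ ∀ n, n₀ ≤ n → v (n + T) = v n + c := by
  have hp0 : (p : ℤ) ≠ 0 := by exact_mod_cast hp.ne_zero
  have hshift : ∀ n x, (∀ i j, (p : ℤ) ^ x ∣ (p : ℤ) ^ K * (A ^ n) i j) ↔ x ≤ K + v n := by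
    intro n x
    rcases le_total x K with h | h
    · exact iff_of_true (fun i j => (pow_dvd_pow _ h).mul_right _) (by omega)
    · obtain ⟨y, rfl⟩ := Nat.exists_eq_add_of_le h
      simp only [pow_add, mul_dvd_mul_iff_left (pow_ne_zero K hp0), ← hv]
      omega
  have hlow' : ∀ q l, r * q + (r * l) ⌈/⌉ s ≤ K + v (l + s * q) := by
    intro q l
    have h1 := hlow (l + s * q)
    have h2 : r * q ≤ K + v (l + s * q) := by
      refine Nat.le_of_mul_le_mul_left ?_ hs
      nlinarith
    obtain ⟨d, hd⟩ := Nat.exists_eq_add_of_le h2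
    rw [hd]
    refine Nat.add_le_add_left ((ceilDiv_le_iff_le_mul hs).mpr ?_) _
    nlinarith
  have hC : ∀ q, ∃ C : Matrix (Fin m) (Fin m) ℤ,
      (p : ℤ) ^ K • A ^ (s * q) = (p : ℤ) ^ (r * q) • C := by
    intro q
    have h := (hshift (s * q) (r * q)).mpr
      (by have := hlow' q 0; simp at this; exact this)
    choose C hC using h
    exact ⟨Matrix.of C, by ext i j; simpa using hC i j⟩
  choose C hC using hC
  have hAC : ∀ l q, (p : ℤ) ^ (r * q) • (A ^ l * C q) = (p : ℤ) ^ K • A ^ (l + s * q) := by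
    intro l q
    rw [← Matrix.mul_smul, ← hC, Matrix.mul_smul, pow_add]
  have hdvd : ∀ l q e, (∀ i j, (p : ℤ) ^ e ∣ (A ^ l * C q) i j) ↔
      r * q + e ≤ K + v (l + s * q) := by
    intro l q e
    rw [← hshift]
    refine forall₂_congr fun i j => ?_
    have h := congrFun (congrFun (hAC l q) i) j
    rw [Matrix.smul_apply, Matrix.smul_apply, smul_eq_mul, smul_eq_mul] at h
    rw [← h, pow_add, mul_dvd_mul_iff_left (pow_ne_zero _ hp0)]
  -- Pigeonhole is applied in this lattice rather than in all integer matrices, because `A ^ l` is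
  -- guaranteed to gain the factor `p ^ ⌈r * l / s⌉` on `Λ`.
  let Λ : Submodule ℤ (Matrix (Fin m) (Fin m) ℤ) := Submodule.span ℤ (Set.range C)
  have hΛ : ∀ Y ∈ Λ, ∀ l i j, (p : ℤ) ^ ((r * l) ⌈/⌉ s) ∣ (A ^ l * Y) i j := by
    intro Y hY l
    induction hY using Submodule.span_induction with
    | mem Y hY =>
      obtain ⟨q, rfl⟩ := hY
      exact (hdvd l q _).mpr (hlow' q l)
    | zero => simp
    | add X Y _ _ hX hY =>
      intro i j
      rw [Matrix.mul_add, Matrix.add_apply]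
      exact dvd_add (hX i j) (hY i j)
    | smul c X _ hX =>
      intro i j
      rw [Matrix.mul_smul, Matrix.smul_apply]
      exact (hX i j).mul_left _
  obtain ⟨a, b, hab, ⟨Y, hY⟩, h⟩ := Module.exists_lt_sub_eq_smul (M := Λ)
    (pow_ne_zero (K + 1) hp0) fun q => ⟨C q, Submodule.subset_span ⟨q, rfl⟩⟩
  have hCab : C b - C a = (p : ℤ) ^ (K + 1) • Y := congrArg Subtype.val h
  refine ⟨s * a, s * (b - a), r * (b - a), Nat.mul_pos hs (by omega), fun n hn => ?_⟩
  obtain ⟨l, rfl⟩ := Nat.exists_eq_add_of_le' hn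
  -- `A ^ l * C a` and `A ^ l * C b` agree modulo `p ^ (K + 1 + ⌈r * l / s⌉)`.
  have hiff : ∀ e ≤ K + 1 + (r * l) ⌈/⌉ s,
      (r * b + e ≤ K + v (l + s * b) ↔ r * a + e ≤ K + v (l + s * a)) := by
    intro e he
    rw [← hdvd, ← hdvd]
    refine forall₂_congr fun i j => (dvd_iff_dvd_of_dvd_sub ?_)
    rw [← Matrix.sub_apply, ← Matrix.mul_sub, hCab, Matrix.mul_smul, Matrix.smul_apply, smul_eq_mul]
    exact (pow_dvd_pow _ he).trans (pow_add (p : ℤ) _ _ ▸ mul_dvd_mul_left _ (hΛ Y hY l i j))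
  have hva : v (l + s * a) ≤ r * a + (r * l) ⌈/⌉ s := by
    have h1 := hup (l + s * a)
    have h2 := le_smul_ceilDiv (b := r * l) hs
    rw [smul_eq_mul] at h2
    refine Nat.le_of_mul_le_mul_left ?_ hs
    nlinarith
  have hla := hlow' a l
  obtain ⟨d, rfl⟩ := Nat.exists_eq_add_of_lt hab
  -- The exact valuation of `A ^ l * C a` is this exponent, at most `K + ⌈r * l / s⌉` by `hva`. The
  -- extra 1 in the modulus lets the next exponent be tested too, which pins down the valuation of
  -- `A ^ l * C b`.
  have h1 := hiff (K + v (l + s * a) - r * a) (by omega)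
  have h2 := hiff (K + v (l + s * a) - r * a + 1) (by omega)
  have h3 : r * (a + d + 1) = r * a + r * (d + 1) := by ring
  have h4 : l + s * a + s * (d + 1) = l + s * (a + d + 1) := by ring
  rw [show a + d + 1 - a = d + 1 by omega, h4]
  omega

theorem EventuallyPeriodic.of_add_eq {v : ℕ → ℕ} {n₀ T c : ℕ} (hT : 0 < T)
    (h : ∀ n, n₀ ≤ n → v (n + T) = v n + c) :
    EventuallyPeriodic fun n => (v n : ℚ) - (c / T : ℚ) * n := by
  refine ⟨n₀, T, hT, fun n hn => ?_⟩
  have hT' : (T : ℚ) ≠ 0 := by exact_mod_cast hT.ne'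
  simp only [h n hn]
  push_cast
  field_simp
  ring

theorem EventuallyPeriodic.sub_of_add_eq {v : ℕ → ℕ} {n₀ T c : ℕ} (hT : 0 < T)
    (h : ∀ n, n₀ ≤ n → v (n + T) = v n + c) :
    EventuallyPeriodic fun n => (v (n + 1) : ℚ) - v n := by
  refine ⟨n₀, T, hT, fun n hn => ?_⟩
  simp only [h n hn, show n + T + 1 = n + 1 + T by ring, h (n + 1) (by omega)]
  push_cast
  ring

/-- The finite values `v n` of the valuation of `A ^ n` are the sum of a linear term and an
eventually periodic one, and their first differences are eventually periodic. -/
theorem theorem3 (m : ℕ) (A : Matrix (Fin m) (Fin m) ℤ) (hA : ¬ IsNilpotent A)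
    (p : ℕ) (hp : p.Prime) :
    ∃ v : ℕ → ℕ, (∀ n : ℕ, matrixVal p (A ^ n) = (v n : ℕ∞)) ∧
      ∃ (a : ℚ) (h : ℕ → ℚ), 0 ≤ a ∧ EventuallyPeriodic h ∧
        (∀ n : ℕ, (v n : ℚ) = a * (n : ℚ) + h n) ∧
        (∀ n : ℕ, (v (n + 1) : ℚ) - (v n : ℚ) = a + h (n + 1) - h n) ∧
        EventuallyPeriodic (fun n : ℕ => (v (n + 1) : ℚ) - (v n : ℚ)) := by
  have hne : ∀ n, A ^ n ≠ 0 := fun n h => hA ⟨n, h⟩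
  choose v hval hv using fun n => exists_matrixVal_eq hp (hne n)
  obtain ⟨r, s, hs, hc, hup⟩ := A.exists_slope hA hp
  have hlow : ∀ n, r * n ≤ s * v n + r * m := fun n => by
    obtain ⟨w, hw, hle⟩ := A.exists_pow_dvd_pow_of_slope hs hc n
    have := Nat.mul_le_mul_left s ((hv n w).mpr hw)
    omega
  obtain ⟨n₀, T, c, hT, h⟩ := A.exists_val_pow_add_eq hp hv hs hlow
    fun n => hup n _ ((hv n _).mp le_rfl)
  refine ⟨v, hval, c / T, fun n => v n - (c / T : ℚ) * n, by positivity, .of_add_eq hT h,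
    fun n => by ring, fun n => by push_cast; ring, .sub_of_add_eq hT h⟩
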